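/- **Conventions.** Let $S$ be a non-empty semigroup, not necessarily with an identity. For $p\in S$, $X\subseteq S$ put $pX=\{px : x\in X\}$, $p^{-1}X=\{y\in S : py\in X\}$ and $\langle p\rangle=\{p\}\cup pS$ (so $\langle p\rangle = pS$ if $S$ has an identity). $S$ is *right LCM* if it is left cancellative and any $p,q\in S$ with $pS\cap qS\neq\emptyset$ have a right least common multiple, that is, an element $r\in\langle p\rangle\cap\langle q\rangle$ with $pS\cap qS=rS$. (If $S$ has an identity this just says that $pS\cap qS$ is empty or a principal right ideal.) For left cancellative $S$ let $\mathcal J(S)$ be the smallest family of subsets of $S$ that contains $\emptyset$ and $S$ and with $X$ contains $pX$ and $p^{-1}X$ for all $p\in S$. The full semigroup $C^*$-algebra $C^*(S)$ is the universal unital $C^*$-algebra generated by isometries $(v_p)_{p\in S}$ and projections $(e_X)_{X\in\mathcal J(S)}$ with $v_pv_q=v_{pq}$, $v_pe_Xv_p^*=e_{pX}$, $e_\emptyset=0$, $e_S=1$ and $e_Xe_Y=e_{X\cap Y}$. Its diagonal is $\mathcal D=C^*(\{e_X : X\in\mathcal J(S)\})$. The reduced $C^*$-algebra $C^*_r(S)$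 is the unital $C^*$-subalgebra of $\mathcal L(\ell^2(S))$ generated by the isometries $V_p\varepsilon_t=\varepsilon_{pt}$, and the left regular representation is the $*$-homomorphism $\lambda:C^*(S)\to C^*_r(S)$ with $\lambda(v_p)=V_p$. **Theorem.** Let $S$ be a cancellative right LCM semigroup. Suppose that there is a conditional expectation $\Phi_{\mathcal D}:C^*(S)\to\mathcal D$ such that $$\Phi_{\mathcal D}(v_pv_q^*)=\begin{cases}v_pv_p^* & \text{if } p=q,\\ 0 & \text{if } p\neq q,\end{cases}$$ for all $p,q\in S$, or, if $S$ has no identity, for all $p,q$ in the unitisation $\tilde S=S\cup\{1\}$, where $v_1=1$; and suppose that $\Phi_{\mathcal D}$ is faithful, that is, $\Phi_{\mathcal D}(a^*a)=0$ implies $a=0$. Then the left regular representation $\lambda$ is an isomorphism from $C^*(S)$ onto $C^*_r(S)$. -/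

import Mathlib

open scoped ENNReal

universe u

namespace SemigroupCStar

/-! ### Right ideals of a semigroup -/

section Ideals

variable {S : Type u} [Semigroup S]

/-- `pX = {px | x ∈ X}`. -/
def translate (p : S) (X : Set S) : Set S := {y | ∃ x ∈ X, y = p * x}

/-- `p⁻¹X = {y | py ∈ X}`. -/
def pullback (p : S) (X : Set S) : Set S := {y | p * y ∈ X}

/-- The principal right ideal `pS`. -/
def principal (p : S) : Set S := translate p Set.univ

/-- The right ideal `⟨p⟩ = {p} ∪ pS` generated by `p`, which is `pS` if `S` has an identity. -/
def generated (p : S) : Set S := insert p (principal p)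

/-- The family `𝒥(S)` of constructible right ideals, as the smallest family which contains `∅`
and `S` and is closed under `X ↦ pX` and `X ↦ p⁻¹X`. -/
inductive IsConstructible : Set S → Prop
  | empty : IsConstructible ∅
  | univ : IsConstructible Set.univ
  | translate (p : S) {X : Set S} : IsConstructible X → IsConstructible (translate p X)
  | pullback (p : S) {X : Set S} : IsConstructible X → IsConstructible (pullback p X)

/-- Constructible right ideals of a left cancellative semigroup are closed under intersection. -/
theorem IsConstructible.inter [IsLeftCancelMul S] {X Y : Set S}
    (hX : IsConstructible X) (hY : IsConstructible Y) : IsConstructible (X ∩ Y) := by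
  induction hY generalizing X with
  | empty => simpa using IsConstructible.empty
  | univ => simpa using hX
  | @translate p Z _ ih =>
    have : X ∩ SemigroupCStar.translate p Z
        = SemigroupCStar.translate p (SemigroupCStar.pullback p X ∩ Z) := by
      ext y
      constructor
      · rintro ⟨hy, z, hz, rfl⟩
        exact ⟨z, ⟨hy, hz⟩, rfl⟩
      · rintro ⟨z, ⟨hz, hz'⟩, rfl⟩
        exact ⟨hz, z, hz', rfl⟩
    rw [this]
    exact (ih (hX.pullback p)).translate p
  | @pullback p Z _ ih =>
    have : X ∩ SemigroupCStar.pullback p Z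
        = SemigroupCStar.pullback p (SemigroupCStar.translate p X ∩ Z) := by
      ext y
      constructor
      · rintro ⟨hy, hz⟩
        exact ⟨⟨y, hy, rfl⟩, hz⟩
      · rintro ⟨⟨x, hx, hxy⟩, hz⟩
        obtain rfl := mul_left_cancel hxy
        exact ⟨hx, hz⟩
    rw [this]
    exact (ih (hX.translate p)).pullback p

variable (S) in
/-- Right LCM semigroups: `S` is left cancellative and any two elements `p`, `q` which have a right
common multiple have a right least common multiple `r`, i.e. `r ∈ ⟨p⟩ ∩ ⟨q⟩` and `pS ∩ qS = rS`.
If `S` has an identity, then `⟨p⟩ = pS` and the membership of `r` is automatic. -/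
structure IsRightLCM : Prop where
  leftCancel : IsLeftCancelMul S
  lcm : ∀ p q : S, (principal p ∩ principal q).Nonempty →
    ∃ r, r ∈ generated p ∩ generated q ∧ principal p ∩ principal q = principal r

variable (S) in
/-- `S` has a (two-sided) identity element. -/
def HasIdentity : Prop := ∃ u : S, ∀ x : S, u * x = x ∧ x * u = x

end Ideals

/-! ### The full semigroup C*-algebra -/

/-- Isometries `v p`, `p ∈ S`, and projections `e X`, `X ∈ 𝒥(S)`, in the unital C*-algebra `B`
which satisfy the relations (L1)-(L4). -/
structure Representation (S : Type u) [Semigroup S] [IsLeftCancelMul S]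
    (B : Type*) [CStarAlgebra B] where
  v : S → B
  e : {X : Set S // IsConstructible X} → B
  isometry : ∀ p, star (v p) * v p = 1
  projection : ∀ X, IsStarProjection (e X)
  L1 : ∀ p q, v p * v q = v (p * q)
  L2 : ∀ p X, v p * e X * star (v p) = e ⟨translate p X.1, X.2.translate p⟩
  L3_empty : e ⟨∅, .empty⟩ = 0
  L3_univ : e ⟨Set.univ, .univ⟩ = 1
  L4 : ∀ X Y, e X * e Y = e ⟨X.1 ∩ Y.1, X.2.inter Y.2⟩

section Full

variable (S : Type u) [Semigroup S] [IsLeftCancelMul S]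

/-- All representations of the relations in non-zero unital C*-algebras in the universe of `S`.
A C*-algebra generated by such a representation has a dense subset of cardinality at most
`max |S| ℵ₀`, so up to isomorphism none is missed. -/
structure AnyRepresentation : Type (u + 1) where
  alg : Type u
  [cstar : CStarAlgebra alg]
  [nontrivial : Nontrivial alg]
  rep : Representation S alg

attribute [instance] AnyRepresentation.cstar AnyRepresentation.nontrivial

/-- The C*-algebra of bounded families indexed by all representations, with the sup norm. -/
abbrev BoundedFamilies : Type (u + 1) := lp (fun R : AnyRepresentation S => R.alg) ∞

noncomputable instance : CStarAlgebra (BoundedFamilies S) where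

variable {S}

/-- The family of the isometries `v p` of all representations. -/
noncomputable def jointV (p : S) : BoundedFamilies S :=
  ⟨fun R => R.rep.v p, by
    refine memℓp_infty ⟨1, ?_⟩
    rintro _ ⟨R, rfl⟩
    have h : ‖R.rep.v p‖ * ‖R.rep.v p‖ = 1 := by
      rw [← CStarRing.norm_star_mul_self, R.rep.isometry, norm_one]
    nlinarith [norm_nonneg (R.rep.v p)]⟩

/-- The family of the projections `e X` of all representations. -/
noncomputable def jointE (X : {X : Set S // IsConstructible X}) : BoundedFamilies S :=
  ⟨fun R => R.rep.e X, by
    refine memℓp_infty ⟨1, ?_⟩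
    rintro _ ⟨R, rfl⟩
    exact (R.rep.projection X).norm_le⟩

variable (S) in
/-- The universal unital C*-algebra `C*(S)` for the relations (L1)-(L4), realised as the unital
C*-subalgebra generated by the joint families of isometries and projections. -/
noncomputable def fullSubalgebra : StarSubalgebra ℂ (BoundedFamilies S) :=
  (StarAlgebra.adjoin ℂ (Set.range (jointV (S := S)) ∪ Set.range (jointE (S := S)))).topologicalClosure

variable (S) in
/-- The full semigroup C*-algebra `C*(S)`. -/
abbrev Full : Type (u + 1) := fullSubalgebra S

noncomputable instance : CStarAlgebra (Full S) :=
  StarSubalgebra.cstarAlgebra _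
    (h_closed := StarSubalgebra.isClosed_topologicalClosure _)

/-- The generating isometry `v_p` of `C*(S)`. -/
noncomputable def Full.v (p : S) : Full S :=
  ⟨jointV p, StarSubalgebra.le_topologicalClosure _
    (StarAlgebra.subset_adjoin ℂ _ (Or.inl ⟨p, rfl⟩))⟩

/-- The generating projection `e_X` of `C*(S)`. -/
noncomputable def Full.e (X : {X : Set S // IsConstructible X}) : Full S :=
  ⟨jointE X, StarSubalgebra.le_topologicalClosure _
    (StarAlgebra.subset_adjoin ℂ _ (Or.inr ⟨X, rfl⟩))⟩

variable (S) in
/-- The generators of `C*(S)` satisfy the relations (L1)-(L4). -/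
noncomputable def Full.rep : Representation S (Full S) where
  v := Full.v
  e := Full.e
  isometry p := Subtype.ext (lp.ext (funext fun R => R.rep.isometry p))
  projection X :=
    { isIdempotentElem :=
        Subtype.ext (lp.ext (funext fun R => (R.rep.projection X).isIdempotentElem))
      isSelfAdjoint :=
        Subtype.ext (lp.ext (funext fun R => (R.rep.projection X).isSelfAdjoint)) }
  L1 p q := Subtype.ext (lp.ext (funext fun R => R.rep.L1 p q))
  L2 p X := Subtype.ext (lp.ext (funext fun R => R.rep.L2 p X))
  L3_empty := Subtype.ext (lp.ext (funext fun R => R.rep.L3_empty))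
  L3_univ := Subtype.ext (lp.ext (funext fun R => R.rep.L3_univ))
  L4 X Y := Subtype.ext (lp.ext (funext fun R => R.rep.L4 X Y))

/-- The evaluation of bounded families at a representation. -/
noncomputable def evalHom {B : Type u} [CStarAlgebra B] [Nontrivial B]
    (ρ : Representation S B) : BoundedFamilies S →⋆ₐ[ℂ] B where
  toFun a := a ⟨B, ρ⟩
  map_one' := rfl
  map_mul' _ _ := rfl
  map_zero' := rfl
  map_add' _ _ := rfl
  commutes' _ := rfl
  map_star' _ := rfl

/-- The unital `*`-homomorphism `C*(S) → B` with `v_p ↦ ρ.v p` and `e_X ↦ ρ.e X` of a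
representation `ρ` in `B`. -/
noncomputable def Full.lift {B : Type u} [CStarAlgebra B] [Nontrivial B]
    (ρ : Representation S B) : Full S →⋆ₐ[ℂ] B :=
  (evalHom ρ).comp (fullSubalgebra S).subtype

theorem Full.lift_v {B : Type u} [CStarAlgebra B] [Nontrivial B]
    (ρ : Representation S B) (p : S) : Full.lift ρ (Full.v p) = ρ.v p := rfl

theorem Full.lift_e {B : Type u} [CStarAlgebra B] [Nontrivial B]
    (ρ : Representation S B) (X : {X : Set S // IsConstructible X}) :
    Full.lift ρ (Full.e X) = ρ.e X := rfl

open scoped CStarAlgebra in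
/-- A unital `*`-homomorphism on `C*(S)` is determined by its values on the generators. -/
theorem Full.hom_ext {B : Type*} [CStarAlgebra B] {φ ψ : Full S →⋆ₐ[ℂ] B}
    (hv : ∀ p, φ (Full.v p) = ψ (Full.v p)) (he : ∀ X, φ (Full.e X) = ψ (Full.e X)) : φ = ψ := by
  have hφ : Continuous φ := map_continuous φ
  have hψ : Continuous ψ := map_continuous ψ
  refine StarAlgHom.ext_topologicalClosure hφ hψ ?_
  refine StarAlgHom.ext_adjoin ?_
  rintro ⟨x, hx⟩ (⟨p, rfl⟩ | ⟨X, rfl⟩)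
  · exact hv p
  · exact he X

variable (S) in
/-- The diagonal `𝒟 = C*({e_X | X ∈ 𝒥(S)})` of `C*(S)`. -/
noncomputable def diagonal : StarSubalgebra ℂ (Full S) :=
  (StarAlgebra.adjoin ℂ (Set.range (Full.e (S := S)))).topologicalClosure

end Full

/-! ### The reduced semigroup C*-algebra -/

section Reduced

variable (S : Type u)

/-- The Hilbert space `ℓ²(S)`. -/
abbrev L2 : Type u := lp (fun _ : S => ℂ) 2

variable {S}

/-- The canonical orthonormal basis `(ε_t)` of `ℓ²(S)`. -/
noncomputable def basis (S : Type u) : HilbertBasis S ℂ (L2 S) :=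
  HilbertBasis.ofRepr (LinearIsometryEquiv.refl ℂ (L2 S))

theorem clm_ext {f g : L2 S →L[ℂ] L2 S} (h : ∀ t, f (basis S t) = g (basis S t)) : f = g := by
  refine ContinuousLinearMap.ext_on
    (Submodule.dense_iff_topologicalClosure_eq_top.mpr (basis S).dense_span) ?_
  rintro _ ⟨t, rfl⟩
  exact h t

open Classical in
theorem basis_inner (s t : S) : inner ℂ (basis S s) (basis S t) = if s = t then (1 : ℂ) else 0 :=
  orthonormal_iff_ite.mp (basis S).orthonormal s t

section Shift

variable [Semigroup S] [IsLeftCancelMul S]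

theorem orthonormal_shift (p : S) : Orthonormal ℂ (fun t : S => basis S (p * t)) :=
  (basis S).orthonormal.comp _ (mul_right_injective p)

/-- The isometry `V_p` of `ℓ²(S)` with `V_p ε_t = ε_{pt}`. -/
noncomputable def regV (p : S) : L2 S →L[ℂ] L2 S :=
  (orthonormal_shift p).orthogonalFamily.linearIsometry.toContinuousLinearMap

theorem regV_basis (p t : S) : regV p (basis S t) = basis S (p * t) := by
  classical
  have h : basis S t = lp.single 2 t (1 : ℂ) := by
    rw [← (basis S).repr_symm_single]; rfl
  rw [h]
  simp [regV]

theorem regV_isometry (p : S) : star (regV p) * regV p = 1 := by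
  rw [ContinuousLinearMap.star_eq_adjoint]
  ext1 x
  refine ext_inner_right ℂ fun y => ?_
  change inner ℂ (ContinuousLinearMap.adjoint (regV p) (regV p x)) y = inner ℂ x y
  rw [ContinuousLinearMap.adjoint_inner_left]
  exact LinearIsometry.inner_map_map _ x y

end Shift

/-- The orthogonal projection `E_X` of `ℓ²(S)` onto `ℓ²(X)`, the closed span of the `ε_t`,
`t ∈ X`. -/
noncomputable def regE (X : Set S) : L2 S →L[ℂ] L2 S :=
  (Submodule.span ℂ (basis S '' X)).topologicalClosure.starProjection

theorem regE_basis_mem {X : Set S} {t : S} (ht : t ∈ X) : regE X (basis S t) = basis S t :=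
  Submodule.starProjection_eq_self_iff.mpr
    (Submodule.le_topologicalClosure _ (Submodule.subset_span ⟨t, ht, rfl⟩))

theorem regE_basis_notMem {X : Set S} {t : S} (ht : t ∉ X) : regE X (basis S t) = 0 := by
  classical
  refine (Submodule.starProjection_apply_eq_zero_iff _).mpr ?_
  rw [Submodule.orthogonal_closure]
  rw [Submodule.mem_orthogonal]
  intro u hu
  induction hu using Submodule.span_induction with
  | mem x hx =>
    obtain ⟨s, hs, rfl⟩ := hx
    rw [basis_inner, if_neg]
    rintro rfl
    exact ht hs
  | zero => simp
  | add x y _ _ hx hy => rw [inner_add_left, hx, hy, add_zero]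
  | smul c x _ hx => rw [inner_smul_left, hx, mul_zero]

theorem regE_empty : regE (∅ : Set S) = 0 :=
  clm_ext fun t => by rw [regE_basis_notMem (Set.notMem_empty t)]; rfl

theorem regE_univ : regE (Set.univ : Set S) = 1 :=
  clm_ext fun t => by rw [regE_basis_mem (Set.mem_univ t)]; rfl

variable [Semigroup S] [IsLeftCancelMul S]

theorem star_regV_basis (p t : S) : star (regV p) (basis S (p * t)) = basis S t := by
  rw [← regV_basis]
  exact congrArg (fun f : L2 S →L[ℂ] L2 S => f (basis S t)) (regV_isometry p)

theorem star_regV_basis_notMem {p s : S} (hs : s ∉ principal p) :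
    star (regV p) (basis S s) = 0 := by
  classical
  apply (basis S).repr.injective
  ext t
  rw [HilbertBasis.repr_apply_apply, ContinuousLinearMap.star_eq_adjoint,
    ContinuousLinearMap.adjoint_inner_right, regV_basis, basis_inner, if_neg]
  · simp
  · rintro rfl
    exact hs ⟨t, trivial, rfl⟩

theorem regE_translate (p : S) (X : Set S) :
    regV p * regE X * star (regV p) = regE (translate p X) := by
  refine clm_ext fun s => ?_
  simp only [mul_apply_eq_comp]
  by_cases hs : s ∈ principal p
  · obtain ⟨t, -, rfl⟩ := hs
    rw [star_regV_basis]
    by_cases ht : t ∈ X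
    · rw [regE_basis_mem ht, regV_basis, regE_basis_mem (X := translate p X) ⟨t, ht, rfl⟩]
    · rw [regE_basis_notMem ht, map_zero, regE_basis_notMem]
      rintro ⟨x, hx, h⟩
      exact ht (mul_left_cancel h ▸ hx)
  · rw [star_regV_basis_notMem hs, map_zero, map_zero, regE_basis_notMem]
    rintro ⟨x, -, h⟩
    exact hs ⟨x, trivial, h⟩

theorem regE_pullback (p : S) (X : Set S) :
    star (regV p) * regE X * regV p = regE (pullback p X) := by
  refine clm_ext fun t => ?_
  simp only [mul_apply_eq_comp]
  rw [regV_basis]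
  by_cases ht : p * t ∈ X
  · rw [regE_basis_mem ht, star_regV_basis, regE_basis_mem (X := pullback p X) ht]
  · rw [regE_basis_notMem ht, map_zero, regE_basis_notMem (X := pullback p X) ht]

variable (S) in
/-- The operators `V_p` and `E_X` satisfy the relations (L1)-(L4). -/
noncomputable def regRep : Representation S (L2 S →L[ℂ] L2 S) where
  v := regV
  e X := regE X.1
  isometry := regV_isometry
  projection _ := isStarProjection_starProjection
  L1 p q := clm_ext fun t => by
    rw [mul_apply_eq_comp, regV_basis, regV_basis, regV_basis, mul_assoc]
  L2 p X := regE_translate p X.1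
  L3_empty := regE_empty
  L3_univ := regE_univ
  L4 X Y := clm_ext fun t => by
    rw [mul_apply_eq_comp]
    by_cases hY : t ∈ Y.1
    · rw [regE_basis_mem hY]
      by_cases hX : t ∈ X.1
      · rw [regE_basis_mem hX, regE_basis_mem (X := X.1 ∩ Y.1) ⟨hX, hY⟩]
      · rw [regE_basis_notMem hX, regE_basis_notMem fun h => hX h.1]
    · rw [regE_basis_notMem hY, map_zero, regE_basis_notMem fun h => hY h.2]

variable (S) in
/-- The reduced semigroup C*-algebra `C*_r(S)`: the unital C*-subalgebra of the bounded operators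
on `ℓ²(S)` generated by the isometries `V_p`. -/
noncomputable def reduced : StarSubalgebra ℂ (L2 S →L[ℂ] L2 S) :=
  (StarAlgebra.adjoin ℂ (Set.range (regV (S := S)))).topologicalClosure

theorem regV_mem_reduced (p : S) : regV p ∈ reduced S :=
  StarSubalgebra.le_topologicalClosure _ (StarAlgebra.subset_adjoin ℂ _ ⟨p, rfl⟩)

theorem regE_mem_reduced {X : Set S} (hX : IsConstructible X) : regE X ∈ reduced S := by
  induction hX with
  | empty => rw [regE_empty]; exact zero_mem _
  | univ => rw [regE_univ]; exact one_mem _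
  | translate p _ ih =>
    rw [← regE_translate]
    exact mul_mem (mul_mem (regV_mem_reduced p) ih) (star_mem (regV_mem_reduced p))
  | pullback p _ ih =>
    rw [← regE_pullback]
    exact mul_mem (mul_mem (star_mem (regV_mem_reduced p)) ih) (regV_mem_reduced p)

/-! ### The left regular representation -/

variable [Nonempty S]

instance : Nontrivial (L2 S) :=
  ⟨⟨basis S (Classical.arbitrary S), 0, (basis S).orthonormal.ne_zero _⟩⟩

open scoped CStarAlgebra in
theorem lift_regRep_mem_reduced (a : Full S) : Full.lift (regRep S) a ∈ reduced S := by
  have hc : Continuous (evalHom (regRep S)) := map_continuous _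
  have hle : fullSubalgebra S ≤ (reduced S).comap (evalHom (regRep S)) := by
    refine StarSubalgebra.topologicalClosure_minimal (StarAlgebra.adjoin_le ?_) ?_
    · rintro _ (⟨p, rfl⟩ | ⟨X, rfl⟩)
      · exact regV_mem_reduced p
      · exact regE_mem_reduced X.2
    · exact (StarSubalgebra.isClosed_topologicalClosure _).preimage hc
  exact hle a.2

variable (S) in
/-- The left regular representation `λ : C*(S) → C*_r(S)`, the `*`-homomorphism with
`λ(v_p) = V_p`. -/
noncomputable def leftRegular : Full S →⋆ₐ[ℂ] reduced S :=
  (Full.lift (regRep S)).codRestrict (reduced S) lift_regRep_mem_reduced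

theorem leftRegular_v (p : S) : leftRegular S (Full.v p) = ⟨regV p, regV_mem_reduced p⟩ := rfl

end Reduced

/-! ### Conditional expectations -/

/-- `Φ` is a conditional expectation of the unital C*-algebra `A` onto its C*-subalgebra `D`:
a contractive positive linear projection of `A` onto `D` which is `D`-bilinear. -/
structure IsConditionalExpectation {A : Type*} [CStarAlgebra A] (D : StarSubalgebra ℂ A)
    (Φ : A →ₗ[ℂ] A) : Prop where
  mem : ∀ a, Φ a ∈ D
  apply_of_mem : ∀ d ∈ D, Φ d = d
  norm_le : ∀ a, ‖Φ a‖ ≤ ‖a‖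
  positive : ∀ a, ∃ b ∈ D, Φ (star a * a) = star b * b
  bilinear : ∀ c ∈ D, ∀ d ∈ D, ∀ a, Φ (c * a * d) = c * Φ a * d

open Classical in
/-- `Φ` is the canonical conditional expectation `Φ_𝒟` of `C*(S)` onto its diagonal: it maps
`v_p v_q*` to `v_p v_p*` if `p = q` and to `0` if `p ≠ q`. If `S` has no identity, then `p` and `q`
range over the unitisation `S ∪ {1}` with `v_1 = 1`, which adds the monomials `v_p` and `v_q*`. -/
structure IsDiagonalExpectation {S : Type u} [Semigroup S] [IsLeftCancelMul S]
    (Φ : Full S →ₗ[ℂ] Full S) : Prop where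
  isConditionalExpectation : IsConditionalExpectation (diagonal S) Φ
  apply_monomial : ∀ p q : S, Φ (Full.v p * star (Full.v q)) =
    if p = q then Full.v p * star (Full.v p) else 0
  apply_isometry : ¬ HasIdentity S → ∀ p : S, Φ (Full.v p) = 0 ∧ Φ (star (Full.v p)) = 0

end SemigroupCStar

/-! Taking the diagonal matrix entries of λ(a) with respect to the basis (ε_t) gives λ(Φ(a))
(`IsDiagonalExpectation.lift_regRep`). If λ(a) = 0, then λ(Φ(a*a)) = 0; since λ is isometric on 𝒟,
Φ(a*a) = 0, and faithfulness yields a = 0. Surjectivity follows: an injective *-homomorphism has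
closed range, and the range contains every V_p.

Isometry on 𝒟 rests on independence (`IsRightLCM.exists_subset_of_cover`): a non-empty constructible
ideal covered by finitely many others lies in one of them. The constructible ideals are ∅, S and the
pS, so pulling back along p reduces this to X = S. There an identity settles the matter, and without
one cancellation excludes a finite cover by principal ideals. Hence on finitely many e_X a character
of 𝒟 is evaluation at some t in S (`IsRightLCM.exists_point`), so its values are eigenvalues at ε_t,
and Gelfand theory bounds the norm.

For the diagonal entries, least common multiples make the v_p v_q* with p, q in S ∪ {1}, together
with 0, closed under products, so they span a dense subspace. On them right cancellation matches the
entries with Φ. -/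

namespace SemigroupCStar

/-! ### Constructible right ideals of right LCM semigroups -/

section Ideals

variable {S : Type u} [Semigroup S]

theorem translate_principal (p q : S) : translate p (principal q) = principal (p * q) := by
  ext y
  constructor
  · rintro ⟨_, ⟨x, -, rfl⟩, rfl⟩
    exact ⟨x, trivial, (mul_assoc _ _ _).symm⟩
  · rintro ⟨x, -, rfl⟩
    exact ⟨q * x, ⟨x, trivial, rfl⟩, mul_assoc _ _ _⟩

theorem principal_subset_of_mem {p q : S} (h : q ∈ principal p) : principal q ⊆ principal p := by
  obtain ⟨x, -, rfl⟩ := h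
  rintro _ ⟨y, -, rfl⟩
  exact ⟨x * y, trivial, mul_assoc _ _ _⟩

/-- In a cancellative semigroup an element with a right unit forces an identity. -/
theorem hasIdentity_of_mul_eq_self [IsCancelMul S] {z y : S} (h : z * y = z) : HasIdentity S := by
  have hl : ∀ w, y * w = w := fun w => mul_left_cancel (a := z) (by rw [← mul_assoc, h])
  exact ⟨y, fun w => ⟨hl w, mul_right_cancel (b := y) (by rw [mul_assoc, hl])⟩⟩

theorem hasIdentity_of_mul_eq_self' [IsCancelMul S] {z y : S} (h : y * z = z) : HasIdentity S := by
  have hr : ∀ w, w * y = w := fun w => mul_right_cancel (b := z) (by rw [mul_assoc, h])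
  exact ⟨y, fun w => ⟨mul_left_cancel (a := y) (by rw [← mul_assoc, hr]), hr w⟩⟩

/-- A cancellative semigroup which is a finite union of principal right ideals has an identity. -/
theorem hasIdentity_of_finite_cover [Nonempty S] [IsCancelMul S] {F : Set S} (hF : F.Finite)
    (h : ∀ x, ∃ p ∈ F, x ∈ principal p) : HasIdentity S := by
  -- Since x lies in f(x)S, iterating f gives an ascending chain of principal ideals with generators
  -- in F. A repeated generator z then lies in zS.
  choose f hf hx using h
  have hdesc : ∀ (x : S) (k : ℕ), f^[k] x ∈ principal (f^[k + 1] x) := fun x k => by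
    rw [Function.iterate_succ_apply']
    exact hx _
  have hlt : ∀ (x : S) (m k : ℕ), f^[m] x ∈ principal (f^[m + k + 1] x) := by
    intro x m k
    induction k with
    | zero => exact hdesc x m
    | succ k ih => exact principal_subset_of_mem (hdesc x (m + k + 1)) ih
  let x : S := Classical.arbitrary S
  have hmem : ∀ k, f^[k + 1] x ∈ F := fun k => by
    rw [Function.iterate_succ_apply']
    exact hf _
  -- The exponents start at 1 because the starting point x need not belong to F.
  obtain ⟨m, n, hmn, he⟩ : ∃ m n, m < n ∧ f^[m + 1] x = f^[n + 1] x :=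
    hF.exists_lt_map_eq_of_forall_mem hmem
  obtain ⟨k, rfl⟩ := Nat.exists_eq_add_of_lt hmn
  have h1 := hlt x (m + 1) k
  rw [show m + 1 + k + 1 = m + k + 1 + 1 by ring, ← he] at h1
  obtain ⟨y, -, hy⟩ := h1
  exact hasIdentity_of_mul_eq_self hy.symm

/-- The constructible right ideals of a right LCM semigroup are principal, empty, or everything. -/
theorem IsRightLCM.eq_of_isConstructible (hS : IsRightLCM S) {X : Set S} (hX : IsConstructible X) :
    X = ∅ ∨ X = Set.univ ∨ ∃ p, X = principal p := by
  have := hS.leftCancel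
  induction hX with
  | empty => exact Or.inl rfl
  | univ => exact Or.inr (Or.inl rfl)
  | @translate p X _ ih =>
    rcases ih with rfl | rfl | ⟨q, rfl⟩
    · left
      ext y
      simp [translate]
    · exact Or.inr (Or.inr ⟨p, rfl⟩)
    · exact Or.inr (Or.inr ⟨p * q, translate_principal p q⟩)
  | @pullback p X _ ih =>
    rcases ih with rfl | rfl | ⟨q, rfl⟩
    · left
      rfl
    · right; left
      rfl
    · rcases Set.eq_empty_or_nonempty (principal p ∩ principal q) with he | hne
      · left
        ext y
        simp only [Set.mem_empty_iff_false, iff_false]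
        intro hy
        have : p * y ∈ principal p ∩ principal q := ⟨⟨y, trivial, rfl⟩, hy⟩
        rw [he] at this
        exact this
      · right
        obtain ⟨r, ⟨hr, -⟩, h⟩ := hS.lcm p q hne
        have hmem : ∀ y, y ∈ pullback p (principal q) ↔ p * y ∈ principal r := fun y => by
          rw [← h]
          exact ⟨fun hy => ⟨⟨y, trivial, rfl⟩, hy⟩, fun hy => hy.2⟩
        -- The set is p⁻¹(rS): it is S if r = p, and xS if r = px.
        rcases hr with rfl | ⟨x, -, rfl⟩
        · left
          ext y
          rw [hmem]
          exact ⟨fun _ => trivial, fun _ => ⟨y, trivial, rfl⟩⟩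
        · right
          refine ⟨x, ?_⟩
          ext y
          rw [hmem, ← translate_principal]
          constructor
          · rintro ⟨z, hz, he⟩
            exact mul_left_cancel he ▸ hz
          · exact fun hy => ⟨y, hy, rfl⟩

/-- Proper constructible ideals lie in principal ones, so a finite cover by them would force an
identity u. But the member of the cover containing u is a right ideal containing u, hence all of S.
-/
theorem IsRightLCM.exists_eq_univ [Nonempty S] [IsCancelMul S] (hS : IsRightLCM S)
    {F : Set (Set S)} (hF : F.Finite) (hc : ∀ Y ∈ F, IsConstructible Y)
    (h : ∀ x, ∃ Y ∈ F, x ∈ Y) : ∃ Y ∈ F, Y = Set.univ := by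
  by_contra! hne
  have hid : HasIdentity S := by
    have hp : ∀ Y ∈ F, ∃ p, Y ⊆ principal p := fun Y hY => by
      rcases hS.eq_of_isConstructible (hc Y hY) with rfl | rfl | ⟨p, rfl⟩
      · exact ⟨Classical.arbitrary S, Set.empty_subset _⟩
      · exact (hne _ hY rfl).elim
      · exact ⟨p, le_rfl⟩
    choose! g hg using hp
    refine hasIdentity_of_finite_cover (hF.image g) fun x => ?_
    obtain ⟨Y, hY, hxY⟩ := h x
    exact ⟨g Y, ⟨Y, hY, rfl⟩, hg Y hY hxY⟩
  obtain ⟨u, hu⟩ := hid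
  obtain ⟨Y, hY, huY⟩ := h u
  rcases hS.eq_of_isConstructible (hc Y hY) with rfl | rfl | ⟨p, rfl⟩
  · exact huY.elim
  · exact hne _ hY rfl
  · refine hne _ hY (Set.eq_univ_of_forall fun y => ?_)
    obtain ⟨x, -, rfl⟩ := huY
    exact ⟨x * y, trivial, by rw [← mul_assoc, (hu y).1]⟩

/-- Independence of the constructible right ideals of a cancellative right LCM semigroup. -/
theorem IsRightLCM.exists_subset_of_cover [Nonempty S] [IsCancelMul S] (hS : IsRightLCM S)
    {X : Set S} (hX : IsConstructible X) (hX0 : X.Nonempty) {F : Set (Set S)} (hF : F.Finite)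
    (hc : ∀ Y ∈ F, IsConstructible Y) (h : ∀ x ∈ X, ∃ Y ∈ F, x ∈ Y) : ∃ Y ∈ F, X ⊆ Y := by
  rcases hS.eq_of_isConstructible hX with rfl | rfl | ⟨p, rfl⟩
  · exact (Set.not_nonempty_empty hX0).elim
  · obtain ⟨Y, hY, rfl⟩ := hS.exists_eq_univ hF hc fun x => h x trivial
    exact ⟨_, hY, le_rfl⟩
  -- The sets p⁻¹Y cover S, and p⁻¹Y = S means pS ⊆ Y.
  · obtain ⟨_, ⟨Y, hY, rfl⟩, hp⟩ := hS.exists_eq_univ (hF.image (pullback p))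
      (by rintro _ ⟨Y, hY, rfl⟩; exact (hc Y hY).pullback p) fun x => by
        obtain ⟨Y, hY, hx⟩ := h (p * x) ⟨x, trivial, rfl⟩
        exact ⟨_, ⟨Y, hY, rfl⟩, hx⟩
    refine ⟨Y, hY, ?_⟩
    rintro _ ⟨x, -, rfl⟩
    exact hp.ge (Set.mem_univ x)

end Ideals

/-! ### The left regular representation on the diagonal -/

section Diagonal

variable {S : Type u} [Semigroup S] [IsLeftCancelMul S]

theorem mul_comm_of_mem_diagonal (x y : diagonal S) : x * y = y * x := by
  have hcomm : ∀ a ∈ Set.range (Full.e (S := S)), ∀ b ∈ Set.range (Full.e (S := S)),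
      a * b = b * a := by
    rintro _ ⟨X, rfl⟩ _ ⟨Y, rfl⟩
    have h1 := (Full.rep S).L4 X Y
    have h2 := (Full.rep S).L4 Y X
    refine h1.trans (Eq.trans ?_ h2.symm)
    congr 2
    exact Set.inter_comm _ _
  have := StarAlgebra.isMulCommutative_adjoin ℂ hcomm (by
    rintro a ha _ ⟨Y, rfl⟩
    have : star (Full.e Y) = Full.e Y := ((Full.rep S).projection Y).isSelfAdjoint
    rw [this]
    exact hcomm a ha _ ⟨Y, rfl⟩)
  exact (StarSubalgebra.commRingTopologicalClosure
    (StarAlgebra.adjoin ℂ (Set.range (Full.e (S := S)))) this.is_comm.comm).mul_comm x y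

end Diagonal

/-! ### Finitely many generators, eigenvectors and characters in C*-algebras. -/

section General

/-- A *-polynomial involves only finitely many generators. This reduction is needed because
independence concerns finite covers only. -/
theorem mem_adjoin_image_finite {A ι : Type*} [Ring A] [StarRing A] [Algebra ℂ A] [StarModule ℂ A]
    (e : ι → A) {a : A} (ha : a ∈ StarAlgebra.adjoin ℂ (Set.range e)) :
    ∃ F : Set ι, F.Finite ∧ a ∈ StarAlgebra.adjoin ℂ (e '' F) := by
  have hmono : ∀ {F G : Set ι}, F ⊆ G →
      StarAlgebra.adjoin ℂ (e '' F) ≤ StarAlgebra.adjoin ℂ (e '' G) := fun h =>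
    StarAlgebra.adjoin_mono (Set.image_mono h)
  induction ha using StarAlgebra.adjoin_induction with
  | mem x hx =>
    obtain ⟨i, rfl⟩ := hx
    exact ⟨{i}, Set.finite_singleton i, StarAlgebra.subset_adjoin ℂ _ ⟨i, rfl, rfl⟩⟩
  | algebraMap c => exact ⟨∅, Set.finite_empty, algebraMap_mem _ c⟩
  | add x y _ _ ihx ihy =>
    obtain ⟨F, hF, hx⟩ := ihx
    obtain ⟨G, hG, hy⟩ := ihy
    exact ⟨F ∪ G, hF.union hG, add_mem (hmono Set.subset_union_left hx)
      (hmono Set.subset_union_right hy)⟩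
  | mul x y _ _ ihx ihy =>
    obtain ⟨F, hF, hx⟩ := ihx
    obtain ⟨G, hG, hy⟩ := ihy
    exact ⟨F ∪ G, hF.union hG, mul_mem (hmono Set.subset_union_left hx)
      (hmono Set.subset_union_right hy)⟩
  | star x _ ih =>
    obtain ⟨F, hF, hx⟩ := ih
    exact ⟨F, hF, star_mem hx⟩

/-- A vector which is an eigenvector for generators and their adjoints, with eigenvalues given by a
character, is an eigenvector for the generated `*`-algebra. -/
theorem eigenvector_of_mem_adjoin {A H : Type*} [CStarAlgebra A] [NormedAddCommGroup H]
    [InnerProductSpace ℂ H] [CompleteSpace H] (π : A →⋆ₐ[ℂ] (H →L[ℂ] H)) {s : Set A}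
    (D : StarSubalgebra ℂ A) (hs : StarAlgebra.adjoin ℂ s ≤ D) (χ : D →⋆ₐ[ℂ] ℂ) (ξ : H)
    (h : ∀ (x : A) (hx : x ∈ s),
      π x ξ = χ ⟨x, hs (StarAlgebra.subset_adjoin ℂ s hx)⟩ • ξ ∧
      π (star x) ξ = star (χ ⟨x, hs (StarAlgebra.subset_adjoin ℂ s hx)⟩) • ξ)
    {d : A} (hd : d ∈ StarAlgebra.adjoin ℂ s) :
    π d ξ = χ ⟨d, hs hd⟩ • ξ ∧ π (star d) ξ = star (χ ⟨d, hs hd⟩) • ξ := by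
  induction hd using StarAlgebra.adjoin_induction with
  | mem x hx => exact h x hx
  | algebraMap c =>
    have hc : χ ⟨algebraMap ℂ A c, hs (algebraMap_mem _ c)⟩ = c := AlgHomClass.commutes χ c
    rw [hc, ← algebraMap_star_comm, AlgHomClass.commutes, AlgHomClass.commutes]
    exact ⟨rfl, rfl⟩
  | add x y hx hy ihx ihy =>
    have hm : χ ⟨x + y, hs (add_mem hx hy)⟩ = χ ⟨x, hs hx⟩ + χ ⟨y, hs hy⟩ :=
      map_add χ ⟨x, hs hx⟩ ⟨y, hs hy⟩
    rw [hm, star_add, star_add, map_add, map_add, add_smul, add_smul, ← ihx.1, ← ihx.2, ← ihy.1,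
      ← ihy.2]
    exact ⟨rfl, rfl⟩
  | mul x y hx hy ihx ihy =>
    have hm : χ ⟨x * y, hs (mul_mem hx hy)⟩ = χ ⟨x, hs hx⟩ * χ ⟨y, hs hy⟩ :=
      map_mul χ ⟨x, hs hx⟩ ⟨y, hs hy⟩
    rw [hm, star_mul, star_mul, map_mul, map_mul, mul_apply_eq_comp, mul_apply_eq_comp,
      ihy.1, ihx.2, map_smul, map_smul, ihx.1, ihy.2, smul_smul, smul_smul]
    exact ⟨by rw [mul_comm], by rw [mul_comm]⟩
  | star x hx ih =>
    have hm : χ ⟨star x, hs (star_mem hx)⟩ = star (χ ⟨x, hs hx⟩) := map_star χ ⟨x, hs hx⟩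
    rw [hm, star_star, star_star]
    exact ⟨ih.2, ih.1⟩

open WeakDual in
/-- The norm on a commutative C*-subalgebra is determined by the characters. -/
theorem norm_le_of_character {A : Type*} [CStarAlgebra A] (D : StarSubalgebra ℂ A)
    (hcl : IsClosed (D : Set A)) (hcomm : ∀ x y : D, x * y = y * x) (a : D) {C : ℝ} (hC : 0 ≤ C)
    (h : ∀ χ : D →⋆ₐ[ℂ] ℂ, ‖χ a‖ ≤ C) : ‖(a : A)‖ ≤ C := by
  let _ : CommCStarAlgebra D :=
    { StarSubalgebra.cstarAlgebra D (h_closed := hcl) with mul_comm := hcomm }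
  change ‖a‖ ≤ C
  rw [← (gelfandTransform_isometry D).norm_map_of_map_zero (map_zero _) a,
    ContinuousMap.norm_le _ hC]
  -- Characters of a commutative C*-algebra preserve adjoints automatically.
  exact fun χ => h { CharacterSpace.toAlgHom χ with map_star' := map_star χ }

/-- Each χ(a) is an eigenvalue of π(a) at a unit vector, so |χ(a)| ≤ ‖π(a)‖. The vector may depend
on a as well as on χ. -/
theorem norm_le_of_eigenvector {A H : Type*} [CStarAlgebra A] [NormedAddCommGroup H]
    [InnerProductSpace ℂ H] [CompleteSpace H] (π : A →⋆ₐ[ℂ] (H →L[ℂ] H)) (D : StarSubalgebra ℂ A)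
    (hcl : IsClosed (D : Set A)) (hcomm : ∀ x y : D, x * y = y * x) {a : A} (ha : a ∈ D)
    (h : ∀ χ : D →⋆ₐ[ℂ] ℂ, ∃ ξ : H, ‖ξ‖ = 1 ∧ π a ξ = χ ⟨a, ha⟩ • ξ) : ‖a‖ ≤ ‖π a‖ := by
  refine norm_le_of_character D hcl hcomm ⟨a, ha⟩ (norm_nonneg _) fun χ => ?_
  obtain ⟨ξ, hξ, hχ⟩ := h χ
  have h := congrArg norm hχ
  rw [norm_smul, hξ, mul_one] at h
  rw [← h]
  exact ContinuousLinearMap.unit_le_opNorm _ _ hξ.le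

end General

section Diagonal

variable {S : Type u} [Semigroup S] [IsLeftCancelMul S]

theorem adjoin_le_diagonal :
    StarAlgebra.adjoin ℂ (Set.range (Full.e (S := S))) ≤ diagonal S :=
  StarSubalgebra.le_topologicalClosure _

theorem isClosed_diagonal : IsClosed (diagonal S : Set (Full S)) :=
  StarSubalgebra.isClosed_topologicalClosure _

/-- The generating projection `e_X` as an element of the diagonal. -/
noncomputable def diagonalE (X : {X : Set S // IsConstructible X}) : diagonal S :=
  ⟨Full.e X, adjoin_le_diagonal (StarAlgebra.subset_adjoin ℂ _ ⟨X, rfl⟩)⟩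

theorem diagonalE_mul (X Y : {X : Set S // IsConstructible X}) :
    diagonalE X * diagonalE Y = diagonalE ⟨X.1 ∩ Y.1, X.2.inter Y.2⟩ :=
  Subtype.ext ((Full.rep S).L4 X Y)

theorem character_diagonalE (χ : diagonal S →⋆ₐ[ℂ] ℂ)
    (X : {X : Set S // IsConstructible X}) : χ (diagonalE X) = 0 ∨ χ (diagonalE X) = 1 := by
  have h : diagonalE X * diagonalE X = diagonalE X := by
    rw [diagonalE_mul]
    congr 2
    exact Set.inter_self _
  have h' := congrArg χ h
  rw [map_mul] at h'
  rcases eq_or_ne (χ (diagonalE X)) 0 with h0 | h0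
  · exact Or.inl h0
  · exact Or.inr (mul_right_cancel₀ h0 (h'.trans (one_mul _).symm))

variable [Nonempty S]

/-- If a character of the diagonal and a point `t` agree on some constructible right ideals, then
`ε_t` is an eigenvector of the `*`-algebra which they generate, and the eigenvalue is given by the
character. -/
theorem lift_regRep_basis (χ : diagonal S →⋆ₐ[ℂ] ℂ) (t : S)
    {F : Set {X : Set S // IsConstructible X}} (h : ∀ X ∈ F, t ∈ X.1 ↔ χ (diagonalE X) = 1)
    {d : Full S} (hd : d ∈ StarAlgebra.adjoin ℂ (Full.e '' F)) (hd' : d ∈ diagonal S) :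
    Full.lift (regRep S) d (basis S t) = χ ⟨d, hd'⟩ • basis S t := by
  refine (eigenvector_of_mem_adjoin (Full.lift (regRep S)) (diagonal S)
    ((StarAlgebra.adjoin_mono (Set.image_subset_range _ _)).trans adjoin_le_diagonal) χ
    (basis S t) ?_ hd).1
  rintro _ ⟨X, hX, rfl⟩
  have hs : star (Full.e X) = Full.e X := ((Full.rep S).projection X).isSelfAdjoint
  rw [hs]
  change regE X.1 (basis S t) = χ (diagonalE X) • _ ∧
    regE X.1 (basis S t) = star (χ (diagonalE X)) • _
  have hXt := h X hX
  by_cases ht : t ∈ X.1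
  · rw [regE_basis_mem ht, hXt.mp ht]
    simp
  · rw [regE_basis_notMem ht, (character_diagonalE χ X).resolve_right fun h => ht (hXt.mpr h)]
    simp

end Diagonal

/-! ### Characters of the diagonal and independence. -/

section Independence

variable {S : Type u} [Semigroup S] [Nonempty S] [IsCancelMul S]

/-- On finitely many constructible right ideals every character of the diagonal is the evaluation
at a point. -/
theorem IsRightLCM.exists_point (hS : IsRightLCM S) (χ : diagonal S →⋆ₐ[ℂ] ℂ)
    {F : Set {X : Set S // IsConstructible X}} (hF : F.Finite) :
    ∃ t : S, ∀ X ∈ F, t ∈ X.1 ↔ χ (diagonalE X) = 1 := by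
  -- X is the intersection of the members of F on which χ is 1, starting from S. Multiplicativity
  -- keeps the value at 1.
  obtain ⟨X, hX, hXF⟩ : ∃ X : {X : Set S // IsConstructible X}, χ (diagonalE X) = 1 ∧
      ∀ Y ∈ F, χ (diagonalE Y) = 1 → X.1 ⊆ Y.1 := by
    induction F, hF using Set.Finite.induction_on with
    | empty =>
      refine ⟨⟨Set.univ, .univ⟩, ?_, by simp⟩
      rw [← map_one χ]
      exact congrArg χ (Subtype.ext (Full.rep S).L3_univ)
    | @insert Y F _ _ ih =>
      obtain ⟨X, hX, hXF⟩ := ih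
      rcases character_diagonalE χ Y with hY | hY
      · refine ⟨X, hX, ?_⟩
        rintro Z (rfl | hZ) hZ1
        · simp [hZ1] at hY
        · exact hXF Z hZ hZ1
      · refine ⟨⟨X.1 ∩ Y.1, X.2.inter Y.2⟩, ?_, ?_⟩
        · rw [← diagonalE_mul, map_mul, hX, hY, one_mul]
        · rintro Z (rfl | hZ) hZ1
          · exact Set.inter_subset_right
          · exact Set.inter_subset_left.trans (hXF Z hZ hZ1)
  have hX0 : X.1.Nonempty := by
    rw [Set.nonempty_iff_ne_empty]
    intro h0
    obtain rfl : X = ⟨∅, .empty⟩ := Subtype.ext h0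
    have h0 : diagonalE (⟨∅, .empty⟩ : {X : Set S // IsConstructible X}) = 0 :=
      Subtype.ext (Full.rep S).L3_empty
    rw [h0, map_zero] at hX
    exact zero_ne_one hX
  by_contra! hne
  -- If no point of X works, the members of F with χ-value 0 cover X, so one of them, Y, contains X.
  -- Then 1 = χ(e_X) = χ(e_X)χ(e_Y) = 0.
  obtain ⟨_, ⟨Y, ⟨hY, hY0⟩, rfl⟩, hXY⟩ := hS.exists_subset_of_cover X.2 hX0
    (F := Subtype.val '' (F ∩ {Y | χ (diagonalE Y) = 0}))
    ((hF.inter_of_left _).image _) (by rintro _ ⟨Y, -, rfl⟩; exact Y.2) fun t ht => by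
      obtain ⟨Y, hY, h⟩ := hne t
      rcases h with ⟨htY, h⟩ | ⟨htY, h⟩
      · exact ⟨Y.1, ⟨Y, ⟨hY, (character_diagonalE χ Y).resolve_right h⟩, rfl⟩, htY⟩
      · exact (htY (hXF Y hY h ht)).elim
  have h := congrArg χ (diagonalE_mul X Y)
  rw [map_mul, show χ (diagonalE Y) = 0 from hY0, mul_zero] at h
  have hXX : (⟨X.1 ∩ Y.1, X.2.inter Y.2⟩ : {X : Set S // IsConstructible X}) = X :=
    Subtype.ext (Set.inter_eq_left.mpr hXY)
  rw [hXX, hX] at h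
  exact zero_ne_one h

open scoped CStarAlgebra in
theorem continuous_lift_regRep : Continuous (Full.lift (regRep S)) := map_continuous _

theorem IsRightLCM.exists_eigenvector (hS : IsRightLCM S) {d : Full S} (hd' : d ∈ diagonal S)
    (hd : d ∈ StarAlgebra.adjoin ℂ (Set.range (Full.e (S := S)))) (χ : diagonal S →⋆ₐ[ℂ] ℂ) :
    ∃ ξ, ‖ξ‖ = 1 ∧ Full.lift (regRep S) d ξ = χ ⟨d, hd'⟩ • ξ := by
  obtain ⟨F, hF, hdF⟩ := mem_adjoin_image_finite _ hd
  obtain ⟨t, ht⟩ := hS.exists_point χ hF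
  exact ⟨basis S t, (basis S).orthonormal.1 t, lift_regRep_basis χ t ht hdF hd'⟩

theorem norm_le_norm_lift_regRep_of_eigenvector {d : Full S} (hd : d ∈ diagonal S)
    (h : ∀ χ : diagonal S →⋆ₐ[ℂ] ℂ,
      ∃ ξ, ‖ξ‖ = 1 ∧ Full.lift (regRep S) d ξ = χ ⟨d, hd⟩ • ξ) :
    ‖d‖ ≤ ‖Full.lift (regRep S) d‖ :=
  norm_le_of_eigenvector (Full.lift (regRep S)) (diagonal S) isClosed_diagonal
    mul_comm_of_mem_diagonal hd h

/-- The left regular representation is isometric on the diagonal. -/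
theorem IsRightLCM.norm_le_norm_lift_regRep (hS : IsRightLCM S) {d : Full S}
    (hd : d ∈ diagonal S) : ‖d‖ ≤ ‖Full.lift (regRep S) d‖ := by
  -- The point t depends on the finitely many generators in d, so eigenvectors are found only on the
  -- dense *-algebra; the norm estimate survives limits.
  have hcl : IsClosed {d : Full S | ‖d‖ ≤ ‖Full.lift (regRep S) d‖} :=
    isClosed_le continuous_norm continuous_lift_regRep.norm
  have hsub : ((StarAlgebra.adjoin ℂ (Set.range (Full.e (S := S))) : StarSubalgebra ℂ (Full S)) :
      Set (Full S)) ⊆ {d : Full S | ‖d‖ ≤ ‖Full.lift (regRep S) d‖} :=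
    fun d hd =>
      norm_le_norm_lift_regRep_of_eigenvector _ (hS.exists_eigenvector (adjoin_le_diagonal hd) hd)
  exact closure_minimal hsub hcl hd

end Independence

/-! ### Monomials -/

section Monomials

theorem exists_withOne_of_mem_generated {S : Type u} [Semigroup S] {p r : S} (h : r ∈ generated p) :
    ∃ x : WithOne S, (r : WithOne S) = p * x := by
  rcases h with rfl | ⟨x, -, rfl⟩
  · exact ⟨1, (mul_one _).symm⟩
  · exact ⟨x, rfl⟩

variable {S : Type u} [Semigroup S] [IsLeftCancelMul S]

theorem v_mul_star_v (p : S) :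
    Full.v p * star (Full.v p) = Full.e ⟨principal p, IsConstructible.univ.translate p⟩ := by
  have h := (Full.rep S).L2 p ⟨Set.univ, .univ⟩
  rw [(Full.rep S).L3_univ, mul_one] at h
  exact h

variable (S) in
/-- The isometries `v_p`, `p ∈ S ∪ {1}`, with `v_1 = 1`. -/
noncomputable def unitizedV : WithOne S →* Full S :=
  WithOne.lift { toFun := Full.v, map_mul' := fun p q => ((Full.rep S).L1 p q).symm }

theorem unitizedV_coe (p : S) : unitizedV S p = Full.v p := rfl

/-- The monomials `v_p v_q*`, `p, q ∈ S ∪ {1}`, together with `0`. -/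
def IsMonomial (a : Full S) : Prop :=
  a = 0 ∨ ∃ p q : WithOne S, a = unitizedV S p * star (unitizedV S q)

theorem IsMonomial.star {a : Full S} (ha : IsMonomial a) : IsMonomial (star a) := by
  rcases ha with rfl | ⟨p, q, rfl⟩
  · exact Or.inl (star_zero _)
  · exact Or.inr ⟨q, p, by rw [star_mul, star_star]⟩

/-- For p, q in S, v_p* v_q = v_p* e_{pS ∩ qS} v_q. If the intersection is rS with r = px = qy, then
e_{rS} = v_r v_r* and the product collapses to v_x v_y*; if it is empty, the product is 0. The
cofactors x, y may be 1, whence the unitisation. -/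
theorem IsRightLCM.isMonomial_star_mul (hS : IsRightLCM S) (p q : WithOne S) :
    IsMonomial (Star.star (unitizedV S p) * unitizedV S q) := by
  induction p with
  | one => exact Or.inr ⟨q, 1, by simp only [map_one, star_one, one_mul, mul_one]⟩
  | coe p =>
  induction q with
  | one => exact Or.inr ⟨1, p, by simp only [map_one, one_mul, mul_one]⟩
  | coe q =>
  have hv : ∀ x : S, Full.v x * Star.star (Full.v x) * Full.v x = Full.v x := fun x => by
    rw [mul_assoc, show Star.star (Full.v x) * Full.v x = 1 from (Full.rep S).isometry x, mul_one]
  have hv' : ∀ x : S, Star.star (Full.v x) * (Full.v x * Star.star (Full.v x)) =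
      Star.star (Full.v x) := fun x => by
    rw [← mul_assoc, show Star.star (Full.v x) * Full.v x = 1 from (Full.rep S).isometry x, one_mul]
  have hmul : Full.v p * Star.star (Full.v p) * (Full.v q * Star.star (Full.v q)) =
      Full.e ⟨principal p ∩ principal q, (IsConstructible.univ.translate p).inter
        (IsConstructible.univ.translate q)⟩ := by
    rw [v_mul_star_v, v_mul_star_v]
    exact (Full.rep S).L4 _ _
  have heq : Star.star (Full.v p) * Full.v q = Star.star (Full.v p) *
      (Full.v p * Star.star (Full.v p) * (Full.v q * Star.star (Full.v q))) * Full.v q := by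
    rw [← mul_assoc, hv', mul_assoc, hv]
  rw [unitizedV_coe, unitizedV_coe, heq, hmul]
  rcases Set.eq_empty_or_nonempty (principal p ∩ principal q) with he | hne
  · left
    have h0 : Full.e (⟨principal p ∩ principal q, (IsConstructible.univ.translate p).inter
        (IsConstructible.univ.translate q)⟩ : {X : Set S // IsConstructible X}) = 0 := by
      rw [← show Full.e (S := S) ⟨∅, .empty⟩ = 0 from (Full.rep S).L3_empty]
      congr 2
    rw [h0, mul_zero, zero_mul]
  · right
    obtain ⟨r, ⟨hp, hq⟩, h⟩ := hS.lcm p q hne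
    obtain ⟨x, hx⟩ := exists_withOne_of_mem_generated hp
    obtain ⟨y, hy⟩ := exists_withOne_of_mem_generated hq
    refine ⟨x, y, ?_⟩
    have hr : Full.e (⟨principal p ∩ principal q, (IsConstructible.univ.translate p).inter
        (IsConstructible.univ.translate q)⟩ : {X : Set S // IsConstructible X}) =
        Full.v r * Star.star (Full.v r) := by
      rw [v_mul_star_v]
      congr 2
    have hx' : Full.v r = Full.v p * unitizedV S x := by
      rw [← unitizedV_coe, hx, map_mul, unitizedV_coe]
    have hy' : Full.v r = Full.v q * unitizedV S y := by
      rw [← unitizedV_coe, hy, map_mul, unitizedV_coe]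
    rw [hr]
    -- Only v_r* is expanded through q; the remaining v_r is expanded through p, so that both
    -- isometry relations apply.
    conv_lhs => enter [1, 2, 2]; rw [hy']
    rw [hx', star_mul, mul_assoc (Star.star (Full.v p)), mul_assoc (Full.v p * _),
      mul_assoc (Star.star (unitizedV S y)),
      show Star.star (Full.v q) * Full.v q = 1 from (Full.rep S).isometry q, mul_one,
      ← mul_assoc, ← mul_assoc,
      show Star.star (Full.v p) * Full.v p = 1 from (Full.rep S).isometry p, one_mul]

theorem IsRightLCM.isMonomial_mul (hS : IsRightLCM S) {a b : Full S} (ha : IsMonomial a)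
    (hb : IsMonomial b) : IsMonomial (a * b) := by
  rcases ha with rfl | ⟨p, q, rfl⟩
  · exact Or.inl (zero_mul b)
  rcases hb with rfl | ⟨r, s, rfl⟩
  · exact Or.inl (mul_zero _)
  have hassoc : unitizedV S p * Star.star (unitizedV S q) *
      (unitizedV S r * Star.star (unitizedV S s)) =
      unitizedV S p * (Star.star (unitizedV S q) * unitizedV S r) *
        Star.star (unitizedV S s) := by
    simp only [mul_assoc]
  rw [hassoc]
  rcases hS.isMonomial_star_mul q r with h | ⟨x, y, h⟩
  · left
    rw [h, mul_zero, zero_mul]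
  · right
    refine ⟨p * x, s * y, ?_⟩
    rw [h, map_mul, map_mul, star_mul]
    simp only [mul_assoc]

theorem isMonomial_one : IsMonomial (1 : Full S) :=
  Or.inr ⟨1, 1, by simp only [map_one, star_one, mul_one]⟩

theorem IsRightLCM.isMonomial_e (hS : IsRightLCM S) (X : {X : Set S // IsConstructible X}) :
    IsMonomial (Full.e X) := by
  obtain ⟨X, hX⟩ := X
  rcases hS.eq_of_isConstructible hX with rfl | rfl | ⟨p, rfl⟩
  · exact Or.inl (Full.rep S).L3_empty
  · rw [show Full.e ⟨Set.univ, hX⟩ = 1 from (Full.rep S).L3_univ]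
    exact isMonomial_one
  · exact Or.inr ⟨p, p, (v_mul_star_v p).symm⟩

theorem isMonomial_v (p : S) : IsMonomial (Full.v p) :=
  Or.inr ⟨p, 1, by rw [map_one, star_one, mul_one, unitizedV_coe]⟩

end Monomials

/-! ### Density of the span of the monomials. -/

section Dense

/-- The linear span of a set which contains `1` and is closed under products and adjoints contains
the generated `*`-algebra. -/
theorem adjoin_subset_span {A : Type*} [Ring A] [StarRing A] [Algebra ℂ A] [StarModule ℂ A]
    {s : Set A} (M : Set A) (hs : s ⊆ M) (h1 : (1 : A) ∈ M)
    (hmul : ∀ a ∈ M, ∀ b ∈ M, a * b ∈ M) (hstar : ∀ a ∈ M, star a ∈ M) :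
    (StarAlgebra.adjoin ℂ s : Set A) ⊆ Submodule.span ℂ M := by
  intro x hx
  rw [SetLike.mem_coe] at hx ⊢
  induction hx using StarAlgebra.adjoin_induction with
  | mem x hx => exact Submodule.subset_span (hs hx)
  | algebraMap c =>
    rw [Algebra.algebraMap_eq_smul_one]
    exact Submodule.smul_mem _ _ (Submodule.subset_span h1)
  | add x y _ _ hx hy => exact add_mem hx hy
  | mul x y _ _ hx hy =>
    have h := Submodule.mul_mem_mul hx hy
    rw [Submodule.span_mul_span] at h
    refine Submodule.span_mono ?_ h
    rintro _ ⟨a, ha, b, hb, rfl⟩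
    exact hmul a ha b hb
  | star x hm hx =>
    clear hm
    induction hx using Submodule.span_induction with
    | mem x hx => exact Submodule.subset_span (hstar x hx)
    | zero => rw [star_zero]; exact zero_mem _
    | add x y _ _ hx hy => rw [star_add]; exact add_mem hx hy
    | smul c x _ hx => rw [star_smul]; exact Submodule.smul_mem _ _ hx

/-- The generators of the closure `B` of a `*`-algebra, as elements of `B`, generate a dense
`*`-algebra in `B`. -/
theorem mem_closure_adjoin {A : Type*} [Ring A] [StarRing A] [Algebra ℂ A] [StarModule ℂ A]
    [TopologicalSpace A] [IsTopologicalRing A] [ContinuousStar A] {s : Set A}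
    {B : StarSubalgebra ℂ A} (hB : B = (StarAlgebra.adjoin ℂ s).topologicalClosure) {t : Set B}
    (ht : s ⊆ Subtype.val '' t) (a : B) : a ∈ closure (StarAlgebra.adjoin ℂ t : Set B) := by
  rw [closure_subtype]
  have ha : (a : A) ∈ closure (StarAlgebra.adjoin ℂ s : Set A) := by
    exact hB.le a.2
  refine closure_mono ?_ ha
  have hle : StarAlgebra.adjoin ℂ s ≤ (StarAlgebra.adjoin ℂ t).map B.subtype :=
    StarAlgebra.adjoin_le fun x hx => by
      obtain ⟨y, hy, rfl⟩ := ht hx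
      exact ⟨y, StarAlgebra.subset_adjoin ℂ _ hy, rfl⟩
  exact hle

variable {S : Type u} [Semigroup S] [IsLeftCancelMul S]

theorem IsRightLCM.mem_closure_span_isMonomial (hS : IsRightLCM S) (a : Full S) :
    a ∈ closure (Submodule.span ℂ {a : Full S | IsMonomial a} : Set (Full S)) := by
  have h := mem_closure_adjoin (B := fullSubalgebra S) rfl
    (t := Set.range (Full.v (S := S)) ∪ Set.range (Full.e (S := S))) (by
      rintro _ (⟨p, rfl⟩ | ⟨X, rfl⟩)
      · exact ⟨Full.v p, Or.inl ⟨p, rfl⟩, rfl⟩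
      · exact ⟨Full.e X, Or.inr ⟨X, rfl⟩, rfl⟩) a
  refine closure_mono (adjoin_subset_span {a : Full S | IsMonomial a} ?_ isMonomial_one
    (fun a ha b hb => hS.isMonomial_mul ha hb) fun a ha => IsMonomial.star ha) h
  rintro _ (⟨p, rfl⟩ | ⟨X, rfl⟩)
  · exact isMonomial_v p
  · exact hS.isMonomial_e X

end Dense

/-! ### The conditional expectation and the diagonal of operators on `ℓ²(S)` -/

section Entries

theorem inner_basis_of_ne {S : Type u} {s t : S} (h : s ≠ t) : inner ℂ (basis S s) (basis S t) = (0 : ℂ) := by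
  classical
  rw [basis_inner, if_neg h]

theorem inner_basis_self {S : Type u} (t : S) : inner ℂ (basis S t) (basis S t) = (1 : ℂ) := by
  classical
  rw [basis_inner, if_pos rfl]

/-- An idempotent isometry is 1: multiply v_u v_u = v_u on the left by v_u*. -/
theorem unitizedV_of_identity {S : Type u} [Semigroup S] [IsLeftCancelMul S] {u : S} (hu : ∀ x : S, u * x = x ∧ x * u = x) :
    Full.v u = 1 := by
  have h : Full.v u * Full.v u = Full.v u := by
    have := (Full.rep S).L1 u u
    rw [(hu u).1] at this
    exact this
  have hi : star (Full.v u) * Full.v u = 1 := (Full.rep S).isometry u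
  have h' := congrArg (star (Full.v u) * ·) h
  simpa only [← mul_assoc, hi, one_mul] using h'

variable {S : Type u} [Semigroup S] [IsCancelMul S]

open Classical in
/-- The diagonal entries of `V_p V_q*`. -/
theorem regV_mul_star_regV_inner (p q t : S) :
    inner ℂ (basis S t) ((regV p * star (regV q)) (basis S t)) • basis S t =
      (if p = q then regV p * star (regV p) else 0 : L2 S →L[ℂ] L2 S) (basis S t) := by
  rw [mul_apply_eq_comp]
  by_cases ht : t ∈ principal q
  · obtain ⟨s, -, rfl⟩ := ht
    rw [star_regV_basis, regV_basis]
    split_ifs with h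
    · subst h
      rw [mul_apply_eq_comp, star_regV_basis, regV_basis, inner_basis_self, one_smul]
    -- For t = qs the entry is nonzero only if qs = ps, and right cancellation then gives p = q.
    · rw [inner_basis_of_ne fun he => h (mul_right_cancel he).symm, zero_smul]
      rfl
  · rw [star_regV_basis_notMem ht, map_zero, inner_zero_right, zero_smul]
    split_ifs with h
    · subst h
      rw [mul_apply_eq_comp, star_regV_basis_notMem ht, map_zero]
    · rfl

theorem regV_inner_eq_zero (hid : ¬ HasIdentity S) (p t : S) :
    inner ℂ (basis S t) (regV p (basis S t)) = (0 : ℂ) := by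
  rw [regV_basis]
  exact inner_basis_of_ne fun h => hid (hasIdentity_of_mul_eq_self' h.symm)

theorem star_regV_inner_eq_zero (hid : ¬ HasIdentity S) (p t : S) :
    inner ℂ (basis S t) (star (regV p) (basis S t)) = (0 : ℂ) := by
  rw [ContinuousLinearMap.star_eq_adjoint, ContinuousLinearMap.adjoint_inner_right, regV_basis]
  exact inner_basis_of_ne fun h => hid (hasIdentity_of_mul_eq_self' h)

end Entries

/-! ### Comparison with the diagonal entries, and injectivity. -/

section Expectation

variable {S : Type u} [Semigroup S] [Nonempty S] [IsCancelMul S]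

/-- The left regular representation intertwines `Φ` with the restriction to the diagonal, on the
monomials. -/
theorem IsDiagonalExpectation.lift_regRep_monomial {Φ : Full S →ₗ[ℂ] Full S}
    (hΦ : IsDiagonalExpectation Φ) (t : S) {a : Full S} (ha : IsMonomial a) :
    Full.lift (regRep S) (Φ a) (basis S t) =
      inner ℂ (basis S t) (Full.lift (regRep S) a (basis S t)) • basis S t := by
  classical
  have hS : ∀ p q : S, Full.lift (regRep S) (Φ (Full.v p * star (Full.v q))) (basis S t) =
      inner ℂ (basis S t) (Full.lift (regRep S) (Full.v p * star (Full.v q)) (basis S t)) •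
        basis S t := fun p q => by
    have hl : ∀ p q : S, Full.lift (regRep S) (Full.v p * star (Full.v q)) =
        regV p * star (regV q) := fun p q => by
      rw [map_mul, map_star, Full.lift_v, Full.lift_v]
      rfl
    rw [hl, regV_mul_star_regV_inner, hΦ.apply_monomial]
    split_ifs
    · rw [hl]
    · rw [map_zero]
  rcases ha with rfl | ⟨p, q, rfl⟩
  · rw [map_zero, map_zero]
    change (0 : L2 S) = inner ℂ (basis S t) (0 : L2 S) • _
    rw [inner_zero_right, zero_smul]
  by_cases hid : HasIdentity S
  · obtain ⟨u, hu⟩ := hid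
    -- An identity u of S has v_u = 1 and replaces the adjoined 1, so the formula for p, q in S
    -- covers every nonzero monomial.
    have hV : ∀ p : WithOne S, ∃ p' : S, unitizedV S p = Full.v p' := fun p => by
      induction p with
      | one => exact ⟨u, by rw [map_one, unitizedV_of_identity hu]⟩
      | coe p => exact ⟨p, rfl⟩
    obtain ⟨p', hp⟩ := hV p
    obtain ⟨q', hq⟩ := hV q
    rw [hp, hq]
    exact hS p' q'
  -- Without an identity, the monomials v_p and v_q* need the extra condition on Φ; their diagonal
  -- entries vanish since pt = t would create an identity.
  induction p with
  | one =>
    rw [map_one, one_mul]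
    induction q with
    | one =>
      rw [map_one, star_one, hΦ.isConditionalExpectation.apply_of_mem 1 (one_mem _), map_one]
      change basis S t = inner ℂ (basis S t) (basis S t) • basis S t
      rw [inner_basis_self, one_smul]
    | coe q =>
      rw [unitizedV_coe, (hΦ.apply_isometry hid q).2, map_zero, map_star, Full.lift_v]
      change (0 : L2 S) = inner ℂ (basis S t) (star (regV q) (basis S t)) • basis S t
      rw [star_regV_inner_eq_zero hid, zero_smul]
  | coe p =>
    induction q with
    | one =>
      rw [map_one, star_one, mul_one, unitizedV_coe, (hΦ.apply_isometry hid p).1, map_zero,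
        Full.lift_v]
      change (0 : L2 S) = inner ℂ (basis S t) (regV p (basis S t)) • basis S t
      rw [regV_inner_eq_zero hid, zero_smul]
    | coe q => exact hS p q

/-- The left regular representation intertwines `Φ` with the restriction to the diagonal. -/
theorem IsDiagonalExpectation.lift_regRep (hS : IsRightLCM S) {Φ : Full S →ₗ[ℂ] Full S}
    (hΦ : IsDiagonalExpectation Φ) (t : S) (a : Full S) :
    Full.lift (regRep S) (Φ a) (basis S t) =
      inner ℂ (basis S t) (Full.lift (regRep S) a (basis S t)) • basis S t := by
  have hΦc : Continuous Φ :=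
    AddMonoidHomClass.continuous_of_bound Φ 1 fun a => by
      rw [one_mul]
      exact hΦ.isConditionalExpectation.norm_le a
  have happ : ∀ f : Full S → Full S, Continuous f →
      Continuous fun a => Full.lift (regRep S) (f a) (basis S t) := fun f hf =>
    (continuous_lift_regRep.comp hf).clm_apply continuous_const
  have hinner : Continuous fun a => inner ℂ (basis S t) (Full.lift (regRep S) a (basis S t)) :=
    continuous_const.inner (happ _ continuous_id)
  have hcl : IsClosed {a : Full S | Full.lift (regRep S) (Φ a) (basis S t) =
      inner ℂ (basis S t) (Full.lift (regRep S) a (basis S t)) • basis S t} :=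
    isClosed_eq (happ _ hΦc) (hinner.smul (continuous_const (y := basis S t)))
  refine closure_minimal (fun a ha => ?_) hcl (hS.mem_closure_span_isMonomial a)
  change Full.lift (regRep S) (Φ a) (basis S t) =
    inner ℂ (basis S t) (Full.lift (regRep S) a (basis S t)) • basis S t
  induction ha using Submodule.span_induction with
  | mem a ha => exact hΦ.lift_regRep_monomial t ha
  | zero => exact hΦ.lift_regRep_monomial t (Or.inl rfl)
  | add x y _ _ hx hy =>
    rw [map_add, map_add, map_add, add_apply, add_apply, inner_add_right, add_smul, hx, hy]
  | smul c x _ hx =>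
    rw [map_smul, map_smul, map_smul, smul_apply, smul_apply, inner_smul_right, mul_smul, hx]

/-- The kernel is tested on Φ(a*a), which lies in the diagonal, where the representation does not
decrease norms. -/
theorem lift_regRep_injective (hS : IsRightLCM S) (Φ : Full S →ₗ[ℂ] Full S)
    (hΦ : IsDiagonalExpectation Φ) (hfaithful : ∀ a : Full S, Φ (star a * a) = 0 → a = 0) :
    Function.Injective (Full.lift (regRep S)) := by
  rw [injective_iff_map_eq_zero]
  intro a ha
  refine hfaithful a ?_
  have h0 : Full.lift (regRep S) (star a * a) = 0 := by rw [map_mul, ha, mul_zero]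
  have h1 : Full.lift (regRep S) (Φ (star a * a)) = 0 := clm_ext fun t => by
    rw [hΦ.lift_regRep hS, h0]
    change inner ℂ (basis S t) (0 : L2 S) • _ = (0 : L2 S)
    rw [inner_zero_right, zero_smul]
  have h2 := hS.norm_le_norm_lift_regRep (hΦ.isConditionalExpectation.mem (star a * a))
  rw [h1, norm_zero] at h2
  exact norm_le_zero_iff.mp h2

/-- An injective `*`-homomorphism between C*-algebras has closed range. -/
theorem isClosed_range_of_injective {A B : Type*} [CStarAlgebra A] [CStarAlgebra B]
    (π : A →⋆ₐ[ℂ] B) (h : Function.Injective π) : IsClosed (Set.range π) :=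
  (NonUnitalStarAlgHom.isometry π h).isClosedEmbedding.isClosed_range

theorem reduced_le_range (h : Function.Injective (Full.lift (regRep S))) :
    reduced S ≤ (Full.lift (regRep S)).range := by
  refine StarSubalgebra.topologicalClosure_minimal (StarAlgebra.adjoin_le ?_) ?_
  · rintro _ ⟨p, rfl⟩
    exact ⟨Full.v p, rfl⟩
  · exact isClosed_range_of_injective _ h

end Expectation

end SemigroupCStar

theorem mainTheorem4 {S : Type u} [Semigroup S] [Nonempty S] [IsCancelMul S]
    (hS : SemigroupCStar.IsRightLCM S)
    (Φ : SemigroupCStar.Full S →ₗ[ℂ] SemigroupCStar.Full S)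
    (hΦ : SemigroupCStar.IsDiagonalExpectation Φ)
    (hfaithful : ∀ a : SemigroupCStar.Full S, Φ (star a * a) = 0 → a = 0) :
    Function.Bijective (SemigroupCStar.leftRegular S) := by
  have hinj := SemigroupCStar.lift_regRep_injective hS Φ hΦ hfaithful
  refine ⟨fun a b h => hinj (congrArg Subtype.val h), fun T => ?_⟩
  obtain ⟨a, ha⟩ := SemigroupCStar.reduced_le_range hinj T.2
  exact ⟨a, Subtype.ext ha⟩
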